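/- Let $\mathbb K$ be $\mathbb R$ or $\mathbb C$ and let $d>1$ be an integer. (1) Let $\mathcal H$ be a Hilbert space over $\mathbb K$ of dimension at least $3$ (possibly infinite), and let $x_1,\dots,x_d\in\mathcal H$ be vectors of norm one. Write $\|L\|=\sup\{|L(y_1,\dots,y_d)|:\|y_k\|=1 \text{ for all } k\}$ for a continuous $d$-linear form $L$ on $\mathcal H$; say that $L$ attains its norm at $(x_1,\dots,x_d)$ if $|L(x_1,\dots,x_d)|=\|L\|$. Then either no continuous symmetric $d$-linear form $L:\mathcal H^d\to\mathbb K$ of norm one attains its norm at $(x_1,\dots,x_d)$, or infinitely many do. Moreover, the same dichotomy holds when the value is prescribed: for every $c\in\mathbb K$ with $|c|=1$, the set of continuous symmetric $d$-linear forms $L$ of norm one with $L(x_1,\dots,x_d)=c$ is either empty or infinite. (2) Let $n\ge 3$. An elementary tensor in $\bigotimes^d\mathbb K^n$ is a tensor of the form $v_1\otimes\cdots\otimes v_d$. A best rank-$1$ approximation of $\mathbf z\in\bigotimes^d\mathbb K^n$ is an elementary tensor $\mathbf x$ that minimizes the distance to $\mathbf z$ among all elementary tensors, for the Hilbert–Schmidt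 norm (the norm of the inner product with $\langle y_1\otimes\cdots\otimes y_d,\,x_1\otimes\cdots\otimes x_d\rangle=\prod_k\langle y_k,x_k\rangle$). If $x_1,\dots,x_d\in\mathbb K^n$ are nonzero, then $x_1\otimes\cdots\otimes x_d$ either is not a best rank-$1$ approximation of any symmetric tensor, or is a best rank-$1$ approximation of infinitely many symmetric tensors. Consequently, a nonzero symmetric tensor can never be recovered from a best rank-$1$ approximation: if $\mathbf z\neq 0$ is symmetric and $\mathbf x$ is a best rank-$1$ approximation of $\mathbf z$, then $\mathbf x$ is a best rank-$1$ approximation of infinitely many symmetric tensors. -/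

import Mathlib

open scoped TensorProduct

noncomputable section

/-- A continuous `d`-linear form is symmetric if permuting its arguments does not change its
value. -/
def IsSymmForm {𝕜 H : Type*} [RCLike 𝕜] [NormedAddCommGroup H] [InnerProductSpace 𝕜 H] {d : ℕ}
    (L : ContinuousMultilinearMap 𝕜 (fun _ : Fin d => H) 𝕜) : Prop :=
  ∀ (η : Equiv.Perm (Fin d)) (y : Fin d → H), L (fun k => y (η k)) = L y

/-- The set of norm one symmetric `d`-linear forms that attain their norm at `(x₁, …, x_d)`
(for unit vectors `x_k`). -/
def normAttaining (𝕜 : Type*) {H : Type*} [RCLike 𝕜] [NormedAddCommGroup H]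
    [InnerProductSpace 𝕜 H] {d : ℕ} (x : Fin d → H) :
    Set (ContinuousMultilinearMap 𝕜 (fun _ : Fin d => H) 𝕜) :=
  {L | IsSymmForm L ∧ ‖L‖ = 1 ∧ ‖L x‖ = ‖L‖}

/-- The tensor product of `d` copies of `𝕜ⁿ`. -/
abbrev TensorSpace (𝕜 : Type*) [RCLike 𝕜] (d n : ℕ) : Type _ :=
  ⨂[𝕜] _ : Fin d, EuclideanSpace 𝕜 (Fin n)

namespace TensorSpace

variable {𝕜 : Type*} [RCLike 𝕜] {d n : ℕ}

/-- The coordinate of a tensor along `e_{i 1} ⊗ ⋯ ⊗ e_{i d}` (standard basis vectors). -/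
def coord (i : Fin d → Fin n) : TensorSpace 𝕜 d n →ₗ[𝕜] 𝕜 :=
  PiTensorProduct.lift ((MultilinearMap.mkPiAlgebra 𝕜 (Fin d) 𝕜).compLinearMap
    fun k => (EuclideanSpace.proj (i k) : EuclideanSpace 𝕜 (Fin n) →L[𝕜] 𝕜).toLinearMap)

/-- The coordinates of an elementary tensor are the products of coordinates of its factors. -/
theorem coord_tprod (i : Fin d → Fin n) (x : Fin d → EuclideanSpace 𝕜 (Fin n)) :
    coord i (PiTensorProduct.tprod 𝕜 x) = ∏ k, x k (i k) := by
  simp [coord]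

/-- The Hilbert-Schmidt inner product of tensors, conjugate linear in the first argument as
everywhere in Mathlib. -/
def hsInner (z w : TensorSpace 𝕜 d n) : 𝕜 :=
  ∑ i : Fin d → Fin n, starRingEnd 𝕜 (coord i z) * coord i w

/-- The characteristic property `⟪x₁ ⊗ ⋯ ⊗ x_d, y₁ ⊗ ⋯ ⊗ y_d⟫ = ∏ ⟪x_k, y_k⟫`. -/
theorem hsInner_tprod (x y : Fin d → EuclideanSpace 𝕜 (Fin n)) :
    hsInner (PiTensorProduct.tprod 𝕜 x) (PiTensorProduct.tprod 𝕜 y) =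
      ∏ k, inner 𝕜 (x k) (y k) := by
  simp only [hsInner, coord_tprod, map_prod, ← Finset.prod_mul_distrib, PiLp.inner_apply,
    RCLike.inner_apply]
  rw [Finset.prod_univ_sum, Fintype.piFinset_univ]
  exact Finset.sum_congr rfl fun i _ => Finset.prod_congr rfl fun k _ => mul_comm _ _

/-- The Hilbert-Schmidt norm of a tensor. -/
def hsNorm (z : TensorSpace 𝕜 d n) : ℝ := √(RCLike.re (hsInner z z))

/-- A tensor is symmetric if it is invariant under all permutations of the factors. -/
def IsSymmetric (z : TensorSpace 𝕜 d n) : Prop :=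
  ∀ η : Equiv.Perm (Fin d),
    PiTensorProduct.reindex 𝕜 (fun _ : Fin d => EuclideanSpace 𝕜 (Fin n)) η z = z

/-- An elementary tensor is one of the form `x₁ ⊗ ⋯ ⊗ x_d`. -/
def IsElementary (x : TensorSpace 𝕜 d n) : Prop :=
  ∃ v : Fin d → EuclideanSpace 𝕜 (Fin n), x = PiTensorProduct.tprod 𝕜 v

/-- `x` is a best rank-one approximation of `z` (for the Hilbert-Schmidt norm): an elementary
tensor that is at least as close to `z` as every other elementary tensor. -/
def IsBestRankOneApprox (x z : TensorSpace 𝕜 d n) : Prop :=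
  IsElementary x ∧ ∀ y : TensorSpace 𝕜 d n, IsElementary y → hsNorm (z - x) ≤ hsNorm (z - y)

/-- The set of symmetric tensors that have `x` as a best rank-one approximation. -/
def symmetricWithBest (x : TensorSpace 𝕜 d n) : Set (TensorSpace 𝕜 d n) :=
  {z | IsSymmetric z ∧ IsBestRankOneApprox x z}

end TensorSpace

end

/-! If a symmetric form attains its norm at `(x₁, …, x_d)`, then the `x_k` span at most two
dimensions (`mem_span_pair_of_attains`). In dimension at least three some unit vector `e` is
therefore orthogonal to every `x_k`. With `P` the projection onto `e`'s complement, the forms `L ∘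
(P, …, P) + s ∏ ⟪e, ·⟫`, `‖s‖ ≤ ‖L‖`, are symmetric, agree with `L` at `x`, still have norm `‖L‖`
(`norm_comp_complementProj_add_le`), and are told apart by their value at `(e, …, e)`.

For tensors, an elementary `x` is a best approximation of `z` exactly when `⟪z, x⟫ = ‖x‖²` and the
form `⟪z, ·⟫` has norm at most `‖x‖` on elementary tensors (`best_approx_in_cone_iff`). This is
again norm attainment, so the same perturbation works. -/

/-! ### Norm attainment forces the vectors into a plane. -/

/-- Equality case of Cauchy–Schwarz: the Riesz vector of `f` must be `K c / ‖c‖`. The factor `‖c‖`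
is kept on the left so that `c = 0` needs no exception. -/
theorem dual_eq_of_attains {𝕜 H : Type*} [RCLike 𝕜] [NormedAddCommGroup H]
    [InnerProductSpace 𝕜 H] [CompleteSpace H] (f : H →ₗ[𝕜] 𝕜) {K : ℝ}
    (hf : ∀ v, ‖f v‖ ≤ K * ‖v‖) {c : H} (hc : f c = ((K * ‖c‖ : ℝ) : 𝕜)) (v : H) :
    (‖c‖ : 𝕜) * f v = K * inner 𝕜 c v := by
  rcases eq_or_ne c 0 with rfl | hc0
  · simp
  have hcpos : 0 < ‖c‖ := norm_pos_iff.2 hc0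
  have hK : 0 ≤ K := nonneg_of_mul_nonneg_left ((norm_nonneg _).trans (hf c)) hcpos
  obtain ⟨w, hw⟩ := (InnerProductSpace.toDual 𝕜 H).surjective (f.mkContinuous K hf)
  have hfw : ∀ u, f u = inner 𝕜 w u := fun u => by
    rw [← InnerProductSpace.toDual_apply_apply, hw]; rfl
  have hwK : ‖w‖ ≤ K := by
    rw [← (InnerProductSpace.toDual 𝕜 H).norm_map w, hw]
    exact f.mkContinuous_norm_le hK hf
  have h0 : (‖c‖ : 𝕜) • w - (K : 𝕜) • c = 0 := by
    rw [← norm_eq_zero, ← sq_eq_zero_iff]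
    refine le_antisymm ?_ (sq_nonneg _)
    rw [@norm_sub_sq 𝕜, inner_smul_left, inner_smul_right, ← hfw, hc, norm_smul, norm_smul]
    simp only [RCLike.conj_ofReal, ← RCLike.ofReal_mul, RCLike.ofReal_re, RCLike.norm_ofReal,
      abs_norm, abs_of_nonneg hK]
    have : (‖c‖ * ‖w‖) ^ 2 ≤ (‖c‖ * K) ^ 2 := by gcongr
    nlinarith
  rw [hfw]
  have := congrArg (fun u => inner 𝕜 u v) h0
  simp only [inner_sub_left, inner_smul_left, RCLike.conj_ofReal, inner_zero_left] at this
  exact sub_eq_zero.1 this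

/-- The consequence of `T(x, a, ·) = ⟪a, ·⟫` for a symmetric trilinear form of norm at most one. -/
theorem trilinear_reflection {𝕜 H : Type*} [RCLike 𝕜] [NormedAddCommGroup H]
    [InnerProductSpace 𝕜 H] [CompleteSpace H] (T : H →ₗ[𝕜] H →ₗ[𝕜] H →ₗ[𝕜] 𝕜)
    (h₁ : ∀ a b c, T a b c = T b a c) (h₂ : ∀ a b c, T a b c = T a c b)
    (hT : ∀ a b c, ‖T a b c‖ ≤ ‖a‖ * ‖b‖ * ‖c‖) {x a : H} (hx : ‖x‖ = 1)
    (ha : ∀ v, T x a v = inner 𝕜 a v) (v : H) :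
    (‖a‖ : 𝕜) ^ 2 * (T x x v + inner 𝕜 x v) =
      2 * (RCLike.re (inner 𝕜 x a) : 𝕜) * inner 𝕜 a v := by
  rcases eq_or_ne a 0 with rfl | ha0
  · simp
  have hn : (‖a‖ : 𝕜) ≠ 0 := by simpa using ha0
  -- `T a a x = T x a a = ‖a‖²` is the largest value the bound on `T a a` allows at the unit vector
  -- `x`.
  have haa : ∀ v, T a a v = (‖a‖ : 𝕜) ^ 2 * inner 𝕜 x v := fun v => by
    have := dual_eq_of_attains (T a a) (hT a a) (c := x)
      (by rw [h₂, h₁, ha, inner_self_eq_norm_sq_to_K, hx]; push_cast; ring) v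
    rw [hx] at this
    push_cast at this
    linear_combination this
  -- `T a ·` swaps the directions of `x` and `a`, so it fixes their sum `b` after rescaling to equal
  -- lengths. Hence `T b b` attains its bound at `a`, and expanding it in `x` and `a` isolates `T x
  -- x`.
  set b : H := (‖a‖ : 𝕜) • x + a with hb
  have hab : ∀ v, T a b v = (‖a‖ : 𝕜) * inner 𝕜 b v := fun v => by
    simp only [hb, map_add, map_smul, LinearMap.add_apply, LinearMap.smul_apply, h₁ a x, ha, haa,
      inner_add_left, inner_smul_left, RCLike.conj_ofReal, smul_eq_mul]
    ring
  have hbb := dual_eq_of_attains (T b b) (hT b b) (c := a)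
    (by rw [h₂, h₁, hab, inner_self_eq_norm_sq_to_K]; push_cast; ring) v
  have hbn : ‖b‖ ^ 2 = 2 * ‖a‖ ^ 2 + 2 * ‖a‖ * RCLike.re (inner 𝕜 x a) := by
    rw [hb, @norm_add_sq 𝕜, inner_smul_left, norm_smul, hx]
    simp only [RCLike.conj_ofReal, RCLike.re_ofReal_mul, RCLike.norm_ofReal, abs_norm]
    ring
  rw [← sq, hbn] at hbb
  simp only [hb, map_add, map_smul, LinearMap.add_apply, LinearMap.smul_apply, h₁ a x, ha, haa,
    smul_eq_mul] at hbb
  push_cast at hbb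
  apply mul_left_cancel₀ hn
  linear_combination hbb

/-- `T x` exchanges `y` and `z`, so it fixes `y + z` and negates `y - z`. Reflection for `T` and
`-T` makes `⟪x, ·⟫ + T x x` and `⟪x, ·⟫ - T x x` multiples of the functionals of `y + z` and `y -
z`; adding them eliminates `T x x`. -/
theorem mem_span_pair_of_trilinear_attains {𝕜 H : Type*} [RCLike 𝕜] [NormedAddCommGroup H]
    [InnerProductSpace 𝕜 H] [CompleteSpace H] (T : H →ₗ[𝕜] H →ₗ[𝕜] H →ₗ[𝕜] 𝕜)
    (h₁ : ∀ a b c, T a b c = T b a c) (h₂ : ∀ a b c, T a b c = T a c b)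
    (hT : ∀ a b c, ‖T a b c‖ ≤ ‖a‖ * ‖b‖ * ‖c‖) {x y z : H} (hx : ‖x‖ = 1) (hy : ‖y‖ = 1)
    (hz : ‖z‖ = 1) (hxyz : T x y z = 1) (hne : z ∉ Submodule.span 𝕜 {y}) :
    x ∈ Submodule.span 𝕜 {y, z} := by
  have hxy : ∀ v, T x y v = inner 𝕜 z v := fun v => by
    simpa [hx, hy, hz] using dual_eq_of_attains (T x y) (hT x y) (c := z) (by simp [*]) v
  have hxz : ∀ v, T x z v = inner 𝕜 y v := fun v => by
    simpa [hx, hy, hz] using dual_eq_of_attains (T x z) (hT x z) (c := y)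
      (by rw [h₂]; simp [*]) v
  have hys : y ∈ Submodule.span 𝕜 {y} := Submodule.mem_span_singleton_self y
  have hadd : y + z ≠ 0 := fun h => hne (by
    rw [← neg_eq_of_add_eq_zero_right h]; exact neg_mem hys)
  have hsub : y - z ≠ 0 := fun h => hne (by rwa [← sub_eq_zero.1 h])
  have e₁ := trilinear_reflection T h₁ h₂ hT (a := y + z) hx fun v => by
    rw [map_add, LinearMap.add_apply, hxy, hxz, inner_add_left, add_comm]
  have e₂ := trilinear_reflection ((-1 : 𝕜) • T) (fun a b c => by simp [h₁ a b c])
    (fun a b c => by simp [h₂ a b c]) (fun a b c => by simpa using hT a b c) (a := y - z) hx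
    fun v => by
      rw [map_sub, LinearMap.sub_apply]
      simp only [LinearMap.smul_apply, smul_eq_mul, hxy, hxz, inner_sub_left]
      ring
  have hp : (‖y + z‖ : 𝕜) ≠ 0 := by simpa using hadd
  have hm : (‖y - z‖ : 𝕜) ≠ 0 := by simpa using hsub
  obtain ⟨r, hr⟩ : ∃ r : ℝ, r = RCLike.re (inner 𝕜 x (y + z)) / ‖y + z‖ ^ 2 := ⟨_, rfl⟩
  obtain ⟨s, hs⟩ : ∃ s : ℝ, s = RCLike.re (inner 𝕜 x (y - z)) / ‖y - z‖ ^ 2 := ⟨_, rfl⟩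
  have key : x = (r : 𝕜) • (y + z) + (s : 𝕜) • (y - z) := by
    refine ext_inner_right 𝕜 fun v => ?_
    rw [inner_add_left, inner_smul_left, inner_smul_left, RCLike.conj_ofReal, RCLike.conj_ofReal,
      hr, hs]
    have f₁ := e₁ v
    have f₂ := e₂ v
    simp only [LinearMap.smul_apply, smul_eq_mul] at f₂
    push_cast
    field_simp
    linear_combination (‖y - z‖ : 𝕜) ^ 2 / 2 * f₁ + (‖y + z‖ : 𝕜) ^ 2 / 2 * f₂
  have hY : y ∈ Submodule.span 𝕜 {y, z} := Submodule.subset_span (by simp)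
  have hZ : z ∈ Submodule.span 𝕜 {y, z} := Submodule.subset_span (by simp)
  rw [key]
  exact add_mem (Submodule.smul_mem _ _ (add_mem hY hZ)) (Submodule.smul_mem _ _ (sub_mem hY hZ))

/-- Freeing three of the variables of a multilinear form. -/
def MultilinearMap.freeThree {𝕜 H : Type*} [RCLike 𝕜] [AddCommGroup H] [Module 𝕜 H] {d : ℕ}
    (L : MultilinearMap 𝕜 (fun _ : Fin d => H) 𝕜) (x : Fin d → H) {i j k : Fin d}
    (hij : i ≠ j) (hik : i ≠ k) (hjk : j ≠ k) : H →ₗ[𝕜] H →ₗ[𝕜] H →ₗ[𝕜] 𝕜 where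
  toFun a := LinearMap.mk₂ 𝕜
    (fun b c => L (Function.update (Function.update (Function.update x i a) j b) k c))
    (fun b b' c => by
      simp only [Function.update_comm hjk, L.map_update_add])
    (fun r b c => by
      simp only [Function.update_comm hjk, L.map_update_smul])
    (fun b c c' => by simp only [L.map_update_add])
    (fun r b c => by simp only [L.map_update_smul])
  map_add' a a' := by
    ext b c
    simp only [LinearMap.mk₂_apply, LinearMap.add_apply, Function.update_comm hij,
      Function.update_comm hik, L.map_update_add]
  map_smul' r a := by
    ext b c
    simp only [LinearMap.mk₂_apply, LinearMap.smul_apply, Function.update_comm hij,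
      Function.update_comm hik, L.map_update_smul, RingHom.id_apply]

theorem mem_span_pair_of_attains {𝕜 H : Type*} [RCLike 𝕜] [NormedAddCommGroup H]
    [InnerProductSpace 𝕜 H] [CompleteSpace H] {d : ℕ}
    (L : MultilinearMap 𝕜 (fun _ : Fin d => H) 𝕜)
    (hsymm : ∀ (η : Equiv.Perm (Fin d)) (y : Fin d → H), L (fun k => y (η k)) = L y)
    (hL : ∀ y, ‖L y‖ ≤ ∏ k, ‖y k‖) {x : Fin d → H} (hx : ∀ k, ‖x k‖ = 1) (hLx : L x = 1)
    {i j k : Fin d} (hij : i ≠ j) (hik : i ≠ k) (hjk : j ≠ k)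
    (hne : x k ∉ Submodule.span 𝕜 {x j}) : x i ∈ Submodule.span 𝕜 {x j, x k} := by
  have happ : ∀ a b c, L.freeThree x hij hik hjk a b c =
    L (Function.update (Function.update (Function.update x i a) j b) k c) := fun _ _ _ => rfl
  refine mem_span_pair_of_trilinear_attains (L.freeThree x hij hik hjk) (fun a b c => ?_)
    (fun a b c => ?_) (fun a b c => ?_) (hx i) (hx j) (hx k) ?_ hne
  · rw [happ, happ, ← hsymm (Equiv.swap i j)]
    congr 1
    ext l
    simp only [Function.update_apply, Equiv.swap_apply_def]
    grind
  · rw [happ, happ, ← hsymm (Equiv.swap j k)]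
    congr 1
    ext l
    simp only [Function.update_apply, Equiv.swap_apply_def]
    grind
  · rw [happ]
    refine (hL _).trans (le_of_eq ?_)
    rw [← Finset.mul_prod_erase _ _ (Finset.mem_univ i),
      ← Finset.mul_prod_erase _ _ (a := j) (by simp [hij.symm]),
      ← Finset.mul_prod_erase _ _ (a := k) (by simp [hik.symm, hjk.symm]),
      Finset.prod_eq_one]
    · simp [hij, hik, hjk, mul_assoc]
    · intro l hl
      simp only [Finset.mem_erase] at hl
      simp [hl, hx]
  · rw [happ]
    simpa using hLx

theorem exists_orthogonal_unit_of_attains {𝕜 H : Type*} [RCLike 𝕜] [NormedAddCommGroup H]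
    [InnerProductSpace 𝕜 H] [CompleteSpace H] (hH : 3 ≤ Module.rank 𝕜 H) {d : ℕ} (hd : 1 < d)
    (L : MultilinearMap 𝕜 (fun _ : Fin d => H) 𝕜)
    (hsymm : ∀ (η : Equiv.Perm (Fin d)) (y : Fin d → H), L (fun k => y (η k)) = L y)
    {K : ℝ} (hK : 0 < K) (hL : ∀ y, ‖L y‖ ≤ K * ∏ k, ‖y k‖) {x : Fin d → H} (hx : ∀ k, x k ≠ 0)
    (hLx : ‖L x‖ = K * ∏ k, ‖x k‖) : ∃ e : H, ‖e‖ = 1 ∧ ∀ k, inner 𝕜 e (x k) = 0 := by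
  have hpos : 0 < ∏ k, ‖x k‖ := Finset.prod_pos fun k _ => norm_pos_iff.2 (hx k)
  have hLx0 : L x ≠ 0 := by rw [← norm_pos_iff, hLx]; positivity
  obtain ⟨p, q, hpq⟩ : ∃ p q : H, ∀ k, x k ∈ Submodule.span 𝕜 {p, q} := by
    let u : Fin d → H := fun k => ((‖x k‖ : 𝕜)⁻¹) • x k
    have hu : ∀ k, ‖u k‖ = 1 := fun k => by
      simp [u, norm_smul, inv_mul_cancel₀ (norm_ne_zero_iff.2 (hx k))]
    have hxu : ∀ k, x k = (‖x k‖ : 𝕜) • u k := fun k => by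
      simp [u, smul_smul, hx k]
    have hprod : (∏ k, (‖x k‖ : 𝕜)) ≠ 0 := by
      exact_mod_cast (RCLike.ofReal_ne_zero (K := 𝕜)).2 hpos.ne'
    have hLxu : L x = (∏ k, (‖x k‖ : 𝕜)) * L u := by
      conv_lhs => rw [funext hxu]
      rw [L.map_smul_univ]; rfl
    have hLu0 : L u ≠ 0 := fun h => hLx0 (by rw [hLxu, h, mul_zero])
    have hLu : ‖L u‖ = K := by
      have := congrArg norm hLxu
      rw [hLx, norm_mul, norm_prod] at this
      simp only [RCLike.norm_ofReal, abs_norm] at this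
      rw [mul_comm] at this
      exact (mul_left_cancel₀ hpos.ne' this).symm
    -- Dividing by `L u` makes the value at the unit vectors exactly `1` and the norm bound `1`.
    have main := fun {i j k} => @mem_span_pair_of_attains 𝕜 H _ _ _ _ d ((L u)⁻¹ • L)
      (fun η y => by simp [hsymm η y])
      (fun y => by
        simp only [smul_apply, norm_smul, norm_inv, hLu]
        rw [inv_mul_le_iff₀ hK]
        exact hL y) u hu (by simp [hLu0]) i j k
    let o : Fin d := ⟨0, by omega⟩
    -- Either all vectors lie on one line, or two independent ones capture each of the others.
    by_cases h : ∃ j, u j ∉ Submodule.span 𝕜 {u o}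
    · obtain ⟨j, hj⟩ := h
      refine ⟨u o, u j, fun k => ?_⟩
      rw [hxu k]
      refine Submodule.smul_mem _ _ ?_
      have hoj : o ≠ j := fun h => hj (by rw [← h]; exact Submodule.mem_span_singleton_self _)
      by_cases hko : k = o
      · exact Submodule.subset_span (by simp [hko])
      by_cases hkj : k = j
      · exact Submodule.subset_span (by simp [hkj])
      exact main hko hkj hoj hj
    · push Not at h
      refine ⟨u o, u o, fun k => ?_⟩
      rw [hxu k, Set.pair_eq_singleton]
      exact Submodule.smul_mem _ _ (h k)
  have htop : Submodule.span 𝕜 {p, q} ≠ ⊤ := fun h => by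
    have h1 : Module.rank 𝕜 (Submodule.span 𝕜 {p, q}) ≤ 2 :=
      (rank_span_le _).trans (Cardinal.mk_insert_le.trans (by simp [one_add_one_eq_two]))
    rw [h, rank_top] at h1
    exact absurd (hH.trans h1) (by norm_num)
  have : FiniteDimensional 𝕜 (Submodule.span 𝕜 {p, q}) :=
    FiniteDimensional.span_of_finite 𝕜 (by simp)
  obtain ⟨e, he, he0⟩ := Submodule.exists_mem_ne_zero_of_ne_bot
    fun h => htop ((Submodule.orthogonal_eq_bot_iff).1 h)
  refine ⟨((‖e‖ : 𝕜)⁻¹) • e, by simp [norm_smul, inv_mul_cancel₀ (norm_ne_zero_iff.2 he0)],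
    fun k => ?_⟩
  rw [inner_smul_left, Submodule.inner_left_of_mem_orthogonal (hpq k) he, mul_zero]

/-! ### Perturbing a form along an orthogonal direction. -/

/-- Cauchy–Schwarz on two of the factors, which is where `1 < d` enters; the remaining factors only
need `a k, b k ≤ c k`. -/
theorem prod_add_prod_le_prod {d : ℕ} (hd : 1 < d) {a b c : Fin d → ℝ} (ha : ∀ k, 0 ≤ a k)
    (hb : ∀ k, 0 ≤ b k) (hc : ∀ k, 0 ≤ c k) (h : ∀ k, a k ^ 2 + b k ^ 2 ≤ c k ^ 2) :
    ∏ k, a k + ∏ k, b k ≤ ∏ k, c k := by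
  have hac : ∀ k, a k ≤ c k := fun k =>
    le_of_sq_le_sq (by nlinarith [h k, sq_nonneg (b k)]) (hc k)
  have hbc : ∀ k, b k ≤ c k := fun k =>
    le_of_sq_le_sq (by nlinarith [h k, sq_nonneg (a k)]) (hc k)
  obtain ⟨m, rfl⟩ : ∃ m, d = m + 2 := ⟨d - 2, by omega⟩
  simp only [Fin.prod_univ_succ, ← mul_assoc]
  have h01 : a 0 * a 1 + b 0 * b 1 ≤ c 0 * c 1 := by
    refine le_of_sq_le_sq ?_ (mul_nonneg (hc 0) (hc 1))
    calc (a 0 * a 1 + b 0 * b 1) ^ 2 ≤ (a 0 ^ 2 + b 0 ^ 2) * (a 1 ^ 2 + b 1 ^ 2) := by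
          nlinarith [sq_nonneg (a 0 * b 1 - b 0 * a 1)]
      _ ≤ c 0 ^ 2 * c 1 ^ 2 := mul_le_mul (h 0) (h 1) (by positivity) (sq_nonneg _)
      _ = (c 0 * c 1) ^ 2 := by ring
  have hpa : ∏ k : Fin m, a k.succ.succ ≤ ∏ k : Fin m, c k.succ.succ :=
    Finset.prod_le_prod (fun k _ => ha _) fun k _ => hac _
  have hpb : ∏ k : Fin m, b k.succ.succ ≤ ∏ k : Fin m, c k.succ.succ :=
    Finset.prod_le_prod (fun k _ => hb _) fun k _ => hbc _
  have hpc : 0 ≤ ∏ k : Fin m, c k.succ.succ := Finset.prod_nonneg fun k _ => hc _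
  calc _ ≤ a 0 * a 1 * ∏ k : Fin m, c k.succ.succ + b 0 * b 1 * ∏ k : Fin m, c k.succ.succ :=
        add_le_add (mul_le_mul_of_nonneg_left hpa (mul_nonneg (ha _) (ha _)))
          (mul_le_mul_of_nonneg_left hpb (mul_nonneg (hb _) (hb _)))
    _ ≤ _ := by rw [← add_mul]; exact mul_le_mul_of_nonneg_right h01 hpc

section Complement

variable {𝕜 H : Type*} [RCLike 𝕜] [NormedAddCommGroup H] [InnerProductSpace 𝕜 H]

/-- The map `y ↦ y - ⟪e, y⟫ e`, for a unit vector `e` the projection onto its complement. -/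
noncomputable def complementProj (𝕜 : Type*) {H : Type*} [RCLike 𝕜] [NormedAddCommGroup H]
    [InnerProductSpace 𝕜 H] (e : H) : H →L[𝕜] H :=
  ContinuousLinearMap.id 𝕜 H - (innerSL 𝕜 e).smulRight e

theorem complementProj_apply (e y : H) : complementProj 𝕜 e y = y - inner 𝕜 e y • e := rfl

theorem complementProj_of_inner_eq_zero {e y : H} (h : inner 𝕜 e y = 0) :
    complementProj 𝕜 e y = y := by
  rw [complementProj_apply, h, zero_smul, sub_zero]

theorem complementProj_self {e : H} (he : ‖e‖ = 1) : complementProj 𝕜 e e = 0 := by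
  simp [complementProj_apply, he]

theorem inner_complementProj_right (e y z : H) :
    inner 𝕜 y (complementProj 𝕜 e z) = inner 𝕜 (complementProj 𝕜 e y) z := by
  simp only [complementProj_apply, inner_sub_left, inner_sub_right, inner_smul_left,
    inner_smul_right, inner_conj_symm]
  ring

theorem norm_complementProj_sq_add {e : H} (he : ‖e‖ = 1) (y : H) :
    ‖complementProj 𝕜 e y‖ ^ 2 + ‖inner 𝕜 e y‖ ^ 2 = ‖y‖ ^ 2 := by
  have h : inner 𝕜 (complementProj 𝕜 e y) (inner 𝕜 e y • e) = 0 := by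
    rw [← inner_complementProj_right, map_smul, complementProj_self he, smul_zero,
      inner_zero_right]
  have := norm_add_sq (𝕜 := 𝕜) (complementProj 𝕜 e y) (inner 𝕜 e y • e)
  rw [h, norm_smul, he, complementProj_apply, sub_add_cancel] at this
  rw [complementProj_apply, this]
  simp

/-- `M` is an arbitrary function, so that this serves both forms and tensor pairings. -/
theorem norm_comp_complementProj_add_le {d : ℕ} (hd : 1 < d) {e : H} (he : ‖e‖ = 1)
    {M : (Fin d → H) → 𝕜} {K : ℝ} (hK : 0 ≤ K) (hM : ∀ y, ‖M y‖ ≤ K * ∏ k, ‖y k‖) {s : 𝕜}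
    (hs : ‖s‖ ≤ K) (y : Fin d → H) :
    ‖M (fun k => complementProj 𝕜 e (y k)) + s * ∏ k, inner 𝕜 e (y k)‖ ≤ K * ∏ k, ‖y k‖ := by
  have h := prod_add_prod_le_prod hd (fun k => norm_nonneg (complementProj 𝕜 e (y k)))
    (fun k => norm_nonneg (inner 𝕜 e (y k))) (fun k => norm_nonneg (y k))
    fun k => (norm_complementProj_sq_add he (y k)).le
  calc _ ≤ K * ∏ k, ‖complementProj 𝕜 e (y k)‖ + K * ∏ k, ‖inner 𝕜 e (y k)‖ := by
        refine (norm_add_le _ _).trans (add_le_add (hM _) ?_)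
        rw [norm_mul, norm_prod]
        gcongr
    _ ≤ _ := by rw [← mul_add]; gcongr

theorem infinite_setOf_norm_le {K : ℝ} (hK : 0 < K) : {s : 𝕜 | ‖s‖ ≤ K}.Infinite := by
  refine ((Set.Icc_infinite hK).image
    (RCLike.ofReal_injective (K := 𝕜)).injOn).mono ?_
  rintro _ ⟨t, ht, rfl⟩
  simpa [abs_of_nonneg ht.1] using ht.2

theorem infinite_normAttaining_apply_eq [CompleteSpace H] (hH : 3 ≤ Module.rank 𝕜 H) {d : ℕ}
    (hd : 1 < d) {x : Fin d → H} (hx : ∀ k, ‖x k‖ = 1)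
    {L : ContinuousMultilinearMap 𝕜 (fun _ : Fin d => H) 𝕜} (hL : L ∈ normAttaining 𝕜 x) :
    {L' ∈ normAttaining 𝕜 x | L' x = L x}.Infinite := by
  obtain ⟨hsymm, hL1, hLx⟩ := hL
  have hbound : ∀ y, ‖L y‖ ≤ 1 * ∏ k, ‖y k‖ := fun y => hL1 ▸ L.le_opNorm y
  obtain ⟨e, he, hex⟩ := exists_orthogonal_unit_of_attains hH hd L.toMultilinearMap hsymm
    one_pos hbound (x := x) (fun k => norm_ne_zero_iff.1 (by simp [hx k]))
    (by simpa [hx] using hLx.trans hL1)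
  let F : 𝕜 → ContinuousMultilinearMap 𝕜 (fun _ : Fin d => H) 𝕜 := fun s =>
    L.compContinuousLinearMap (fun _ => complementProj 𝕜 e) +
      s • (ContinuousMultilinearMap.mkPiAlgebra 𝕜 (Fin d) 𝕜).compContinuousLinearMap
        (fun _ => innerSL 𝕜 e)
  have hF : ∀ s y, F s y =
      L (fun k => complementProj 𝕜 e (y k)) + s * ∏ k, inner 𝕜 e (y k) := fun s y => by
    simp [F]
  have hd0 : d ≠ 0 := by omega
  have hFx : ∀ s, F s x = L x := fun s => by
    rw [hF]
    simp [hex, complementProj_of_inner_eq_zero, hd0]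
  -- Evaluation at `(e, …, e)` recovers `s`, hence `F` is injective.
  have hFe : ∀ s, F s (fun _ => e) = s := fun s => by
    have : L (fun _ : Fin d => (0 : H)) = 0 :=
      L.map_coord_zero (⟨0, by omega⟩ : Fin d) rfl
    rw [hF]
    simp [complementProj_self he, he, this]
  refine ((infinite_setOf_norm_le (𝕜 := 𝕜) one_pos).image (f := F) fun s _ t _ hst => ?_).mono ?_
  · rw [← hFe s, hst, hFe]
  · rintro _ ⟨s, hs, rfl⟩
    have hle : ‖F s‖ ≤ 1 := ContinuousMultilinearMap.opNorm_le_bound zero_le_one fun y => by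
      rw [hF]
      exact norm_comp_complementProj_add_le hd he zero_le_one hbound hs y
    have hxle : ‖F s x‖ ≤ ‖F s‖ := by simpa [hx] using (F s).le_opNorm x
    have hx1 : ‖F s x‖ = 1 := by rw [hFx, hLx, hL1]
    have h1 : ‖F s‖ = 1 := le_antisymm hle (hx1 ▸ hxle)
    refine ⟨⟨fun η y => ?_, h1, hx1.trans h1.symm⟩, hFx s⟩
    rw [hF, hF, hsymm η fun k => complementProj 𝕜 e (y k),
      Equiv.prod_comp η fun k => inner 𝕜 e (y k)]

end Complement

/-! ### Best approximation from a cone in an inner product space. -/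

/-- By Pythagoras on each line `𝕜 y`, minimizing the distance to `z` amounts to maximizing the
length of the projection of `z`. -/
theorem best_approx_in_cone_iff {𝕜 E : Type*} [RCLike 𝕜] [NormedAddCommGroup E]
    [InnerProductSpace 𝕜 E] {S : Set E} (hS : ∀ (t : 𝕜), ∀ y ∈ S, t • y ∈ S) {x z : E}
    (hx : x ∈ S) :
    (∀ y ∈ S, ‖z - x‖ ≤ ‖z - y‖) ↔
      inner 𝕜 z x = (‖x‖ : 𝕜) ^ 2 ∧ ∀ y ∈ S, ‖inner 𝕜 z y‖ ≤ ‖x‖ * ‖y‖ := by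
  constructor
  · intro h
    have hproj : ∀ y ∈ S, y ≠ 0 → ∃ t : 𝕜, t • y ∈ S ∧ inner 𝕜 (z - t • y) y = 0 := by
      intro y hy hy0
      refine ⟨inner 𝕜 y z / (‖y‖ : 𝕜) ^ 2, hS _ y hy, ?_⟩
      have : (‖y‖ : 𝕜) ≠ 0 := by simpa using hy0
      rw [inner_sub_left, inner_smul_left, inner_self_eq_norm_sq_to_K, map_div₀, inner_conj_symm,
        map_pow, RCLike.conj_ofReal]
      field_simp
      ring
    have hpyth : ∀ (y : E) (t r : 𝕜), inner 𝕜 (z - t • y) y = 0 →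
        ‖z - r • y‖ ^ 2 = ‖z - t • y‖ ^ 2 + ‖(t - r) • y‖ ^ 2 := fun y t r h => by
      have : z - r • y = (z - t • y) + (t - r) • y := by rw [sub_smul]; abel
      rw [this, @norm_add_sq 𝕜, inner_smul_right, h]
      simp
    have hzx : inner 𝕜 (z - x) x = 0 := by
      rcases eq_or_ne x 0 with rfl | hx0
      · simp
      obtain ⟨t, ht, hto⟩ := hproj x hx hx0
      have h1 := hpyth x t 1 hto
      have h2 := h _ ht
      rw [one_smul] at h1
      have h3 : ‖z - x‖ ^ 2 ≤ ‖z - t • x‖ ^ 2 := by gcongr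
      have h4 : ‖(t - 1) • x‖ = 0 := by
        rw [← sq_eq_zero_iff]
        exact le_antisymm (by linarith) (sq_nonneg _)
      rw [norm_eq_zero, sub_smul, one_smul, sub_eq_zero] at h4
      rwa [h4] at hto
    have hzx' : inner 𝕜 z x = (‖x‖ : 𝕜) ^ 2 := by
      rw [inner_sub_left, sub_eq_zero] at hzx
      rw [hzx, inner_self_eq_norm_sq_to_K]
    refine ⟨hzx', fun y hy => ?_⟩
    rcases eq_or_ne y 0 with rfl | hy0
    · simp
    obtain ⟨t, ht, hto⟩ := hproj y hy hy0
    have h1 := hpyth y t 0 hto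
    have h2 := hpyth x 1 0 (by rwa [one_smul])
    simp only [zero_smul, sub_zero, one_smul] at h1 h2
    have h3 : ‖z - x‖ ^ 2 ≤ ‖z - t • y‖ ^ 2 := by
      have := h _ ht
      gcongr
    have h4 : ‖t • y‖ ≤ ‖x‖ := le_of_sq_le_sq (by linarith) (norm_nonneg _)
    have h5 : inner 𝕜 z y = inner 𝕜 (t • y) y := by
      rwa [inner_sub_left, sub_eq_zero] at hto
    rw [h5]
    exact (norm_inner_le_norm _ _).trans (by gcongr)
  · rintro ⟨hzx, hle⟩ y hy
    refine le_of_sq_le_sq ?_ (norm_nonneg _)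
    have h1 : RCLike.re (inner 𝕜 z x) = ‖x‖ ^ 2 := by
      rw [hzx]; exact_mod_cast RCLike.ofReal_re (K := 𝕜) _
    have h2 := (RCLike.re_le_norm (inner 𝕜 z y)).trans (hle y hy)
    rw [@norm_sub_sq 𝕜, @norm_sub_sq 𝕜 _ _ _ _ z y, h1]
    -- `‖z - y‖² ≥ ‖z‖² - 2‖x‖‖y‖ + ‖y‖² ≥ ‖z‖² - ‖x‖² = ‖z - x‖²`.
    nlinarith [sq_nonneg (‖x‖ - ‖y‖)]

/-! ### Symmetric tensors and the Hilbert–Schmidt pairing. -/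

namespace TensorSpace

variable {𝕜 : Type*} [RCLike 𝕜] {d n : ℕ}

/-- The coordinates of a tensor, as a vector of a Euclidean space. -/
noncomputable def coords (𝕜 : Type*) [RCLike 𝕜] (d n : ℕ) :
    TensorSpace 𝕜 d n →ₗ[𝕜] EuclideanSpace 𝕜 (Fin d → Fin n) :=
  (WithLp.linearEquiv 2 𝕜 ((Fin d → Fin n) → 𝕜)).symm.toLinearMap ∘ₗ LinearMap.pi coord

theorem coords_apply (z : TensorSpace 𝕜 d n) (i : Fin d → Fin n) :
    coords 𝕜 d n z i = coord i z := rfl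

theorem coords_injective : Function.Injective (coords 𝕜 d n) := by
  intro z w h
  let b := Basis.piTensorProduct fun _ : Fin d => (EuclideanSpace.basisFun (Fin n) 𝕜).toBasis
  have hb : ∀ i, (Finsupp.lapply i ∘ₗ b.repr.toLinearMap) = coord (𝕜 := 𝕜) i := fun i => by
    refine PiTensorProduct.ext (MultilinearMap.ext fun x => ?_)
    simp [b, coord_tprod]
  refine b.ext_elem fun i => ?_
  have h1 := congrArg (fun u => u i) h
  simp only [coords_apply, ← hb] at h1
  exact h1

theorem hsInner_eq (z w : TensorSpace 𝕜 d n) :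
    hsInner z w = inner 𝕜 (coords 𝕜 d n z) (coords 𝕜 d n w) := by
  simp only [hsInner, PiLp.inner_apply, RCLike.inner_apply, coords_apply]
  exact Finset.sum_congr rfl fun i _ => mul_comm _ _

theorem hsNorm_eq (z : TensorSpace 𝕜 d n) : hsNorm z = ‖coords 𝕜 d n z‖ := by
  rw [hsNorm, hsInner_eq, norm_eq_sqrt_re_inner (𝕜 := 𝕜)]

theorem hsNorm_tprod (x : Fin d → EuclideanSpace 𝕜 (Fin n)) :
    hsNorm (PiTensorProduct.tprod 𝕜 x) = ∏ k, ‖x k‖ := by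
  rw [hsNorm, hsInner_tprod]
  simp only [inner_self_eq_norm_sq_to_K, ← RCLike.ofReal_pow, ← RCLike.ofReal_prod,
    RCLike.ofReal_re, Finset.prod_pow]
  exact Real.sqrt_sq (Finset.prod_nonneg fun k _ => norm_nonneg _)

theorem IsElementary.smul (hd : d ≠ 0) {x : TensorSpace 𝕜 d n} (hx : IsElementary x) (t : 𝕜) :
    IsElementary (t • x) := by
  obtain ⟨v, rfl⟩ := hx
  let o : Fin d := ⟨0, Nat.pos_of_ne_zero hd⟩
  exact ⟨Function.update v o (t • v o), by
    rw [MultilinearMap.map_update_smul, Function.update_eq_self]⟩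

theorem isBestRankOneApprox_tprod_iff (hd : d ≠ 0) (v : Fin d → EuclideanSpace 𝕜 (Fin n))
    (z : TensorSpace 𝕜 d n) :
    IsBestRankOneApprox (PiTensorProduct.tprod 𝕜 v) z ↔
      hsInner z (PiTensorProduct.tprod 𝕜 v) = ((∏ k, ‖v k‖ : ℝ) : 𝕜) ^ 2 ∧
        ∀ y : Fin d → EuclideanSpace 𝕜 (Fin n),
          ‖hsInner z (PiTensorProduct.tprod 𝕜 y)‖ ≤ (∏ k, ‖v k‖) * ∏ k, ‖y k‖ := by
  have h := best_approx_in_cone_iff (𝕜 := 𝕜) (S := coords 𝕜 d n '' {x | IsElementary x})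
    (x := coords 𝕜 d n (PiTensorProduct.tprod 𝕜 v)) (z := coords 𝕜 d n z)
    (by
      rintro t _ ⟨y, hy, rfl⟩
      exact ⟨t • y, hy.smul hd t, map_smul _ _ _⟩) ⟨_, ⟨v, rfl⟩, rfl⟩
  simp only [Set.forall_mem_image, ← map_sub, ← hsNorm_eq, ← hsInner_eq, hsNorm_tprod] at h
  rw [IsBestRankOneApprox, and_iff_right ⟨v, rfl⟩]
  refine h.trans (and_congr_right fun _ => ⟨fun H y => ?_, fun H y hy => ?_⟩)
  · simpa only [hsNorm_tprod] using H ⟨y, rfl⟩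
  · obtain ⟨y, rfl⟩ := hy
    simpa only [hsNorm_tprod] using H y

theorem eq_zero_of_hsInner_tprod {z : TensorSpace 𝕜 d n}
    (h : ∀ y, hsInner z (PiTensorProduct.tprod 𝕜 y) = 0) : z = 0 := by
  have hspan : ∀ w : TensorSpace 𝕜 d n, hsInner z w = 0 := fun w => by
    induction w using PiTensorProduct.induction_on with
    | smul_tprod r f => rw [hsInner_eq, map_smul, inner_smul_right, ← hsInner_eq, h, mul_zero]
    | add a b ha hb => rw [hsInner_eq, map_add, inner_add_right, ← hsInner_eq, ← hsInner_eq, ha,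
        hb, add_zero]
  refine coords_injective ?_
  rw [map_zero, ← inner_self_eq_zero (𝕜 := 𝕜), ← hsInner_eq, hspan]

/-- The `d`-linear form `y ↦ ⟪z, y₁ ⊗ ⋯ ⊗ y_d⟫` of a tensor `z`. -/
noncomputable def form (z : TensorSpace 𝕜 d n) :
    MultilinearMap 𝕜 (fun _ : Fin d => EuclideanSpace 𝕜 (Fin n)) 𝕜 :=
  ((innerSL 𝕜 (coords 𝕜 d n z)).toLinearMap ∘ₗ coords 𝕜 d n).compMultilinearMap
    (PiTensorProduct.tprod 𝕜)

theorem form_apply (z : TensorSpace 𝕜 d n) (y : Fin d → EuclideanSpace 𝕜 (Fin n)) :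
    form z y = hsInner z (PiTensorProduct.tprod 𝕜 y) := by
  rw [hsInner_eq]; rfl

theorem hsInner_reindex (η : Equiv.Perm (Fin d)) (z w : TensorSpace 𝕜 d n) :
    hsInner (PiTensorProduct.reindex 𝕜 (fun _ => EuclideanSpace 𝕜 (Fin n)) η z)
      (PiTensorProduct.reindex 𝕜 (fun _ => EuclideanSpace 𝕜 (Fin n)) η w) = hsInner z w := by
  have hc : ∀ (i : Fin d → Fin n) (u : TensorSpace 𝕜 d n),
      coord i (PiTensorProduct.reindex 𝕜 (fun _ => EuclideanSpace 𝕜 (Fin n)) η u) =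
        coord (fun k => i (η k)) u := fun i u => by
    induction u using PiTensorProduct.induction_on with
    | smul_tprod r f =>
      rw [map_smul, map_smul, map_smul, PiTensorProduct.reindex_tprod]
      congr 1
      erw [coord_tprod, coord_tprod]
      rw [← Equiv.prod_comp η]
      exact Finset.prod_congr rfl fun k _ =>
        congrArg (fun l => f l (i (η k))) (η.symm_apply_apply k)
    | add a b ha hb => rw [map_add, map_add, map_add, ha, hb]
  simp only [hsInner, hc]
  exact Equiv.sum_comp (Equiv.arrowCongr η.symm (Equiv.refl (Fin n)))
    fun i => starRingEnd 𝕜 (coord i z) * coord i w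

theorem IsSymmetric.form_perm {z : TensorSpace 𝕜 d n} (hz : IsSymmetric z)
    (η : Equiv.Perm (Fin d)) (y : Fin d → EuclideanSpace 𝕜 (Fin n)) :
    form z (fun k => y (η k)) = form z y := by
  rw [form_apply, form_apply, ← hsInner_reindex η, hz η]
  congr 1
  erw [PiTensorProduct.reindex_tprod]
  simp

theorem hsInner_map_complementProj (e : EuclideanSpace 𝕜 (Fin n)) (z : TensorSpace 𝕜 d n)
    (y : Fin d → EuclideanSpace 𝕜 (Fin n)) :
    hsInner (PiTensorProduct.map (fun _ => (complementProj 𝕜 e).toLinearMap) z)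
      (PiTensorProduct.tprod 𝕜 y) =
      hsInner z (PiTensorProduct.tprod 𝕜 fun k => complementProj 𝕜 e (y k)) := by
  induction z using PiTensorProduct.induction_on with
  | smul_tprod r f =>
    rw [map_smul, PiTensorProduct.map_tprod, hsInner_eq, hsInner_eq, map_smul, map_smul,
      inner_smul_left, inner_smul_left, ← hsInner_eq, ← hsInner_eq, hsInner_tprod, hsInner_tprod]
    simp only [inner_complementProj_right]
    rfl
  | add a b ha hb =>
    rw [map_add, hsInner_eq, hsInner_eq, map_add, map_add, inner_add_left, inner_add_left,
      ← hsInner_eq, ← hsInner_eq, ← hsInner_eq, ← hsInner_eq, ha, hb]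

theorem infinite_symmetricWithBest (hd : 1 < d) (hn : 3 ≤ n)
    {v : Fin d → EuclideanSpace 𝕜 (Fin n)} (hv : ∀ k, v k ≠ 0) {z : TensorSpace 𝕜 d n}
    (hz : z ∈ symmetricWithBest (PiTensorProduct.tprod 𝕜 v)) :
    (symmetricWithBest (PiTensorProduct.tprod 𝕜 v)).Infinite := by
  obtain ⟨hsymm, hbest⟩ := hz
  have hd0 : d ≠ 0 := by omega
  rw [isBestRankOneApprox_tprod_iff hd0] at hbest
  obtain ⟨hzv, hbound⟩ := hbest
  have hK : 0 < ∏ k, ‖v k‖ := Finset.prod_pos fun k _ => norm_pos_iff.2 (hv k)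
  obtain ⟨e, he, hev⟩ := exists_orthogonal_unit_of_attains (𝕜 := 𝕜)
    (by rw [rank_eq_card_basis (EuclideanSpace.basisFun (Fin n) 𝕜).toBasis, Fintype.card_fin]
        exact_mod_cast hn) hd (form z) hsymm.form_perm hK
    (fun y => by rw [form_apply]; exact hbound y) hv
    (by rw [form_apply, hzv, ← RCLike.ofReal_pow, RCLike.norm_ofReal, abs_of_nonneg (sq_nonneg _),
          sq])
  -- The tensor version of the perturbed form; `s` appears conjugated below because `hsInner` is
  -- conjugate linear in its first argument.
  let F : 𝕜 → TensorSpace 𝕜 d n := fun s =>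
    PiTensorProduct.map (fun _ => (complementProj 𝕜 e).toLinearMap) z +
      s • PiTensorProduct.tprod 𝕜 fun _ => e
  have hF : ∀ s y, hsInner (F s) (PiTensorProduct.tprod 𝕜 y) =
      hsInner z (PiTensorProduct.tprod 𝕜 fun k => complementProj 𝕜 e (y k)) +
        starRingEnd 𝕜 s * ∏ k, inner 𝕜 e (y k) := fun s y => by
    rw [← hsInner_map_complementProj, ← hsInner_tprod, hsInner_eq, map_add, map_smul,
      inner_add_left, inner_smul_left, ← hsInner_eq, ← hsInner_eq]
  have hFe : ∀ s, hsInner (F s) (PiTensorProduct.tprod 𝕜 fun _ => e) = starRingEnd 𝕜 s :=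
    fun s => by
      have : PiTensorProduct.tprod 𝕜 (fun _ : Fin d => (0 : EuclideanSpace 𝕜 (Fin n))) = 0 :=
        (PiTensorProduct.tprod 𝕜).map_coord_zero (⟨0, by omega⟩ : Fin d) rfl
      rw [hF]
      simp [complementProj_self he, this, he, hsInner_eq]
  refine ((infinite_setOf_norm_le (𝕜 := 𝕜) hK).image (f := F) fun s _ t _ hst => ?_).mono ?_
  · refine (starRingEnd 𝕜).injective ?_
    rw [← hFe s, hst, hFe]
  · rintro _ ⟨s, hs, rfl⟩
    refine ⟨fun η => ?_, (isBestRankOneApprox_tprod_iff hd0 _ _).2 ⟨?_, fun y => ?_⟩⟩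
    · rw [map_add, map_smul]
      congr 1
      · exact (PiTensorProduct.map_reindex
          (fun _ : Fin d => (complementProj 𝕜 e).toLinearMap) η z).symm.trans
          (congrArg _ (hsymm η))
      · exact congrArg _ (PiTensorProduct.reindex_tprod η fun _ => e)
    · rw [hF, ← hzv]
      simp [complementProj_of_inner_eq_zero, hev, hd0]
    · rw [hF]
      exact norm_comp_complementProj_add_le hd he hK.le hbound (by simpa using hs) y

/-- A zero factor would make `x = 0`, so `z` would be orthogonal to all elementary tensors, which
span. -/
theorem IsBestRankOneApprox.exists_eq_tprod (hd : d ≠ 0) {x z : TensorSpace 𝕜 d n}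
    (hx : IsBestRankOneApprox x z) (hz : z ≠ 0) :
    ∃ v : Fin d → EuclideanSpace 𝕜 (Fin n), (∀ k, v k ≠ 0) ∧ x = PiTensorProduct.tprod 𝕜 v := by
  obtain ⟨v, rfl⟩ := hx.1
  refine ⟨v, fun k hk => hz (eq_zero_of_hsInner_tprod fun y => ?_), rfl⟩
  have h := ((isBestRankOneApprox_tprod_iff hd v z).1 hx).2 y
  rw [Finset.prod_eq_zero (Finset.mem_univ k) (by rw [hk, norm_zero]), zero_mul] at h
  exact norm_le_zero_iff.1 h

end TensorSpace

theorem mainTheorem11 {𝕜 : Type*} [RCLike 𝕜] {H : Type*} [NormedAddCommGroup H]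
    [InnerProductSpace 𝕜 H] [CompleteSpace H] (hH : 3 ≤ Module.rank 𝕜 H) (d : ℕ) (hd : 1 < d) :
    -- norm attaining symmetric forms, for any unit vectors `x₁, …, x_d` of `H`
    (∀ x : Fin d → H, (∀ k, ‖x k‖ = 1) →
      (normAttaining 𝕜 x = ∅ ∨ (normAttaining 𝕜 x).Infinite) ∧
      ∀ c : 𝕜, ‖c‖ = 1 →
        {L ∈ normAttaining 𝕜 x | L x = c} = ∅ ∨ {L ∈ normAttaining 𝕜 x | L x = c}.Infinite) ∧
    -- symmetric tensors and their best rank-one approximations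
    (∀ n : ℕ, 3 ≤ n →
      (∀ x : Fin d → EuclideanSpace 𝕜 (Fin n), (∀ k, x k ≠ 0) →
        TensorSpace.symmetricWithBest (PiTensorProduct.tprod 𝕜 x) = ∅ ∨
          (TensorSpace.symmetricWithBest (PiTensorProduct.tprod 𝕜 x)).Infinite) ∧
      ∀ z : TensorSpace 𝕜 d n, z.IsSymmetric → z ≠ 0 →
        ∀ x : TensorSpace 𝕜 d n, x.IsBestRankOneApprox z →
          (TensorSpace.symmetricWithBest x).Infinite) := by
  refine ⟨fun x hx => ?_, fun n hn => ⟨fun x hx => ?_, fun z hz hz0 x hx => ?_⟩⟩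
  · refine ⟨?_, fun c _ => ?_⟩
    · refine (normAttaining 𝕜 x).eq_empty_or_nonempty.imp_right fun ⟨L, hL⟩ => ?_
      exact (infinite_normAttaining_apply_eq hH hd hx hL).mono (Set.sep_subset _ _)
    · refine Set.eq_empty_or_nonempty _ |>.imp_right fun ⟨L, hL, hLc⟩ => ?_
      exact hLc ▸ infinite_normAttaining_apply_eq hH hd hx hL
  · exact Set.eq_empty_or_nonempty _ |>.imp_right fun ⟨z, hz⟩ =>
      TensorSpace.infinite_symmetricWithBest hd hn hx hz
  · obtain ⟨v, hv, rfl⟩ := hx.exists_eq_tprod (by omega) hz0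
    exact TensorSpace.infinite_symmetricWithBest hd hn hv ⟨hz, hx⟩
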